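/- Let $a<b$ be real, $n\ge 1$, $d\ge 2$, $1<q<\infty$, and let $C\subsetneq\mathbb R^d$ be a nonempty closed convex cone with dual cone $C^+=\{\zeta\in\mathbb R^d : \zeta\cdot z\ge 0\ \text{for all } z\in C\}$. Let $L:[a,b]\times\mathbb R^n\times\mathbb R^n\to\mathbb R^d$, $(t,y,p)\mapsto L(t,y,p)$, be of class $C^1$ and suppose that there is a constant $K_1$ such that every component satisfies $$|L_i(t,y,p)|\le K_1\,(|y|^q+|p|^q+1)\qquad\text{for all } t\in[a,b],\ y,p\in\mathbb R^n .$$ For fixed $y_A,y_B\in\mathbb R^n$ let $$\mathcal X_1=\{y\in W^{1,q}([a,b];\mathbb R^n) : y(a)=y_A,\ y(b)=y_B\}$$ (arcs being identified with their continuous representatives), and for $y\in\mathcal X_1$ and $\zeta\in\mathbb R^d$ put $$J(y)=\int_a^b L(t,y(t),\dot y(t))\,dt,\qquad J_\zeta(y)=\zeta\cdot J(y),\qquad L_\zeta=\zeta\cdot L,$$ $$\overline L(t,y,p)=L(t,y,p)+C,\qquad \overline J(y)=\int_a^b\overline L(t,y(t),\dot y(t))\,dt ,$$ where the last integral is the Aumann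 integral (the set of the integrals of all integrable selections). Let $\mathcal G(\mathbb R^d,C)=\{D\subseteq\mathbb R^d : D=\mathrm{cl}\,\mathrm{co}\,(D+C)\}$, ordered by $\supseteq$; in it the infimum of a family $\mathcal A$ is $\inf\mathcal A=\mathrm{cl}\,\mathrm{co}\bigcup_{D\in\mathcal A}D$. For $\zeta\in C^+\setminus\{0\}$, a $\zeta$-solution is an arc $y_\zeta\in\mathcal X_1$ with $J_\zeta(y_\zeta)=\min_{y\in\mathcal X_1}J_\zeta(y)$. A set $M\subseteq\mathcal X_1$ is an infimizer if $\inf_{y\in M}\overline J(y)=\inf_{y\in\mathcal X_1}\overline J(y)$ in $\mathcal G(\mathbb R^d,C)$, and a $C^+$-solution if it is an infimizer each of whose elements is a $\zeta$-solution for some $\zeta\in C^+\setminus\{0\}$. A base of $C^+$ is a set $B\subseteq C^+\setminus\{0\}$ such that for each $\zeta\in C^+\setminus\{0\}$ there are unique $\zeta_0\in B$ and $s>0$ with $\zeta=s\zeta_0$. Let $B$ be a base of $C^+$. Assume that there are $\alpha>0$ and $\beta\ge 0$ such that $$L_\zeta(t,y,p)\ge\alpha|p|^q-\beta\qquad\text{for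 all }\zeta\in B,\ t\in[a,b],\ y,p\in\mathbb R^n ,$$ and that for every $t\in[a,b]$ the set-valued function $(y,p)\mapsto\overline L(t,y,p)$ is convex, i.e. has a convex graph. Then for every $\zeta\in C^+\setminus\{0\}$ a $\zeta$-solution exists, and for every choice of a $\zeta$-solution $y_\zeta$ for each $\zeta\in B$ the set $$M=\{y_\zeta : \zeta\in B\}$$ is a $C^+$-solution. The set of all $\zeta$-solutions with $\zeta\in B$ is a $C^+$-solution as well. -/

import Mathlib

open MeasureTheory Set
open scoped ContDiff Pointwise

namespace SetCalcVar

/-- Euclidean space `ℝᵏ`. -/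
abbrev E (k : ℕ) : Type := EuclideanSpace ℝ (Fin k)

/-! ### Sobolev arcs

An arc of `W^{1,q}([a,b]; ℝⁿ)` is represented by its continuous representative on `[a,b]`, written
as a function `ℝ → ℝⁿ` of which only the values on `[a,b]` are ever used. -/

/-- `v` is a weak derivative of `y` on the open interval `(a,b)`. -/
def HasWeakDeriv {n : ℕ} (a b : ℝ) (y v : ℝ → E n) : Prop :=
  LocallyIntegrableOn v (Ioo a b) ∧
  ∀ φ : ℝ → ℝ, ContDiff ℝ ∞ φ → HasCompactSupport φ → tsupport φ ⊆ Ioo a b →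
    ∫ t in Ioo a b, deriv φ t • y t = - ∫ t in Ioo a b, φ t • v t

open Classical in
/-- The weak derivative `ẏ` on `(a,b)` (unique up to null sets), with value `0` if `y` has none. -/
noncomputable def weakDeriv {n : ℕ} (a b : ℝ) (y : ℝ → E n) : ℝ → E n :=
  if h : ∃ v, HasWeakDeriv a b y v then h.choose else 0

/-- `y` is (the continuous representative of) an element of `W^{1,q}([a,b]; ℝⁿ)`: it is continuous
on `[a,b]` (hence in `L^q`) and has a weak derivative in `L^q`. -/
def MemSobolev {n : ℕ} (a b q : ℝ) (y : ℝ → E n) : Prop :=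
  ContinuousOn y (Icc a b) ∧
  ∃ v, HasWeakDeriv a b y v ∧ MemLp v (ENNReal.ofReal q) (volume.restrict (Ioo a b))

/-- The admissible arcs: `W^{1,q}` arcs with `y(a) = yA` and `y(b) = yB`. -/
def admissible {n : ℕ} (a b q : ℝ) (yA yB : E n) : Set (ℝ → E n) :=
  {y | MemSobolev a b q y ∧ y a = yA ∧ y b = yB}

/-! ### The functional and its set-valued extension -/

/-- `J(y) = ∫_a^b L(t, y(t), ẏ(t)) dt`. -/
noncomputable def J {n d : ℕ} (a b : ℝ) (L : ℝ → E n → E n → E d) (y : ℝ → E n) : E d :=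
  ∫ t in a..b, L t (y t) (weakDeriv a b y t)

/-- The set-valued Lagrangian `L(t,y,p) + C`. -/
def Lbar {n d : ℕ} (C : ProperCone ℝ (E d)) (L : ℝ → E n → E n → E d)
    (t : ℝ) (y p : E n) : Set (E d) :=
  {L t y p} + (C : Set (E d))

/-- The Aumann integral over `[a,b]` of a set-valued function: the set of the integrals of all its
integrable selections. -/
def aumannIntegral {d : ℕ} (a b : ℝ) (S : ℝ → Set (E d)) : Set (E d) :=
  {z | ∃ f : ℝ → E d, IntegrableOn f (Icc a b) ∧
    (∀ᵐ t ∂(volume.restrict (Icc a b)), f t ∈ S t) ∧ ∫ t in a..b, f t = z}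

/-- The set-valued functional, the Aumann integral of `L(t, y(t), ẏ(t)) + C` over `[a,b]`. -/
def Jbar {n d : ℕ} (a b : ℝ) (C : ProperCone ℝ (E d)) (L : ℝ → E n → E n → E d)
    (y : ℝ → E n) : Set (E d) :=
  aumannIntegral a b fun t => Lbar C L t (y t) (weakDeriv a b y t)

/-- A set-valued function is convex if its graph is convex. -/
def SetConvex {X : Type*} [AddCommMonoid X] [Module ℝ X] {d : ℕ} (f : X → Set (E d)) : Prop :=
  Convex ℝ {x : X × E d | x.2 ∈ f x.1}

/-- The infimum in the complete lattice, ordered by `⊇`, of the closed convex sets `A` with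
`A = cl co (A + C)`. -/
def infG {d : ℕ} (𝒜 : Set (Set (E d))) : Set (E d) :=
  closure (convexHull ℝ (⋃₀ 𝒜))

/-! ### Solution concepts -/

/-- The dual cone `C⁺ = {ζ | ζ · z ≥ 0 for all z ∈ C}`. -/
noncomputable abbrev dualCone {d : ℕ} (C : ProperCone ℝ (E d)) : ProperCone ℝ (E d) :=
  ProperCone.innerDual (C : Set (E d))

/-- `B` is a base of the cone `K`: a subset of `K \ {0}` such that every element of `K \ {0}` is
`s • ζ₀` for unique `ζ₀ ∈ B` and `s > 0`. -/
def IsConeBase {d : ℕ} (K : ProperCone ℝ (E d)) (B : Set (E d)) : Prop :=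
  B ⊆ (K : Set (E d)) \ {0} ∧
  ∀ ζ ∈ (K : Set (E d)) \ {0}, ∃! x : E d × ℝ, x.1 ∈ B ∧ 0 < x.2 ∧ ζ = x.2 • x.1

/-- `y` minimizes `J_ζ = ζ · J` over the set `𝒳` of arcs. -/
def IsZetaSolution {n d : ℕ} (a b : ℝ) (L : ℝ → E n → E n → E d) (𝒳 : Set (ℝ → E n))
    (ζ : E d) (y : ℝ → E n) : Prop :=
  y ∈ 𝒳 ∧ ∀ w ∈ 𝒳, inner ℝ ζ (J a b L y) ≤ inner ℝ ζ (J a b L w)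

/-- `M ⊆ 𝒳` is an infimizer. -/
def IsInfimizer {n d : ℕ} (a b : ℝ) (C : ProperCone ℝ (E d)) (L : ℝ → E n → E n → E d)
    (𝒳 M : Set (ℝ → E n)) : Prop :=
  M ⊆ 𝒳 ∧ infG (Jbar a b C L '' M) = infG (Jbar a b C L '' 𝒳)

/-- A `C⁺`-solution: an infimizer that consists only of `ζ`-solutions with `ζ ∈ C⁺ \ {0}`. -/
def IsCPlusSolution {n d : ℕ} (a b : ℝ) (C : ProperCone ℝ (E d)) (L : ℝ → E n → E n → E d)
    (𝒳 M : Set (ℝ → E n)) : Prop :=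
  IsInfimizer a b C L 𝒳 M ∧
  ∀ y ∈ M, ∃ ζ ∈ (dualCone C : Set (E d)) \ {0}, IsZetaSolution a b L 𝒳 ζ y

end SetCalcVar

/-!
The statement has two halves: each scalarized functional `J_ζ` attains its minimum on the
admissible arcs, and the minimizers, one for each direction `ζ` of a base, generate the whole
infimum.

**Existence.** Convexity of the graph of `(y, p) ↦ L(t, y, p) + C` makes `L_ζ(t, ·, ·)` jointly
convex for `ζ ∈ C⁺` (`convexOn_inner_of_setConvex`), so `J_ζ` is convex and its sublevel sets form
a decreasing sequence of convex sets of derivatives, bounded in `L^q` by coercivity. In place of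
weak compactness of `L^q` the proof uses a selection principle (`exists_seq_tendsto_of_convex`):
members `w j` of the sublevel sets that nearly minimize the auxiliary strictly convex functional
`∫ √(1 + |w|²)` have nearly minimizing midpoints, so the convexity gaps are summable. The bound
`areaGap_bound` turns this into convergence almost everywhere. As `q > 1`, the bound in `L^q` gives
uniform integrability, hence convergence in `L¹`. An arc is the primitive of its weak derivative
(`HasWeakDeriv.eq_primitive`, from the du Bois-Reymond lemma), so the arcs converge pointwise to an
admissible arc, and Fatou's lemma for `L_ζ + β ≥ 0` shows that the limit is a minimizer
(`exists_isZetaSolution`). An arbitrary `ζ ∈ C⁺ \ {0}` is a positive multiple of an element of the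
base.

**Infimizers.** The Aumann integral `Jbar y` contains `J y + C`, and every `ζ ∈ C⁺` is minimized
over it at `J y`. If a point of some `Jbar x` were outside the closed convex hull of the sets
`Jbar y`, `y ∈ M`, a functional would strictly separate it. That functional lies in `C⁺ \ {0}`, as
the hull is stable under adding `C`, and so it is a positive multiple of some `ζ` in the base. This
contradicts the minimality of the `ζ`-solution in `M` (`isInfimizer_of_forall_isZetaSolution`).
-/

namespace SetCalcVar

open Filter Topology ENNReal

/-! ### Quantitative strict convexity and almost everywhere convergence -/

section Selection

variable {F : Type*} [NormedAddCommGroup F]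

/-- The strictly convex function `p ↦ √(1 + |p|²)`, of linear growth. -/
noncomputable def areaFn (p : F) : ℝ := √(1 + ‖p‖ ^ 2)

lemma areaFn_sq (p : F) : areaFn p ^ 2 = 1 + ‖p‖ ^ 2 := Real.sq_sqrt (by positivity)

lemma one_le_areaFn (p : F) : 1 ≤ areaFn p :=
  Real.one_le_sqrt.2 (by nlinarith [sq_nonneg ‖p‖])

lemma areaFn_le (p : F) : areaFn p ≤ 1 + ‖p‖ :=
  Real.sqrt_le_left (by positivity) |>.2 (by nlinarith [norm_nonneg p])

lemma continuous_areaFn : Continuous (areaFn : F → ℝ) := by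
  unfold areaFn; fun_prop

variable {α : Type*} [MeasurableSpace α] {μ : Measure α}

/-- A family that is bounded in `L^q`, `q > 1`, is uniformly integrable. -/
lemma unifIntegrable_of_eLpNorm_le {ι : Type*} {q : ℝ≥0∞} (hq : 1 < q) {w : ι → α → F}
    (hw : ∀ i, AEStronglyMeasurable (w i) μ) {K : ℝ≥0∞} (hK : K ≠ ⊤)
    (h : ∀ i, eLpNorm (w i) q μ ≤ K) : UnifIntegrable w 1 μ := by
  intro ε hε
  have hr : 0 < 1 / (1 : ℝ≥0∞).toReal - 1 / q.toReal := by
    by_cases hqt : q = ⊤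
    · simp [hqt]
    · have : 1 < q.toReal := by
        rw [← ENNReal.toReal_one]; exact (ENNReal.toReal_lt_toReal (by simp) hqt).2 hq
      simpa using inv_lt_one_of_one_lt₀ this
  set r := 1 / (1 : ℝ≥0∞).toReal - 1 / q.toReal
  have ht : Tendsto (fun x : ℝ => K * (ENNReal.ofReal x) ^ r) (𝓝[>] 0) (𝓝 0) := by
    have h1 : Tendsto (fun x : ℝ => (ENNReal.ofReal x) ^ r) (𝓝 0) (𝓝 0) := by
      have := ((ENNReal.continuous_rpow_const (y := r)).comp ENNReal.continuous_ofReal).tendsto 0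
      simpa [Function.comp_def, ENNReal.zero_rpow_of_pos hr] using this
    have := ENNReal.Tendsto.const_mul (a := K) h1 (Or.inr hK)
    rw [mul_zero] at this
    exact this.mono_left nhdsWithin_le_nhds
  obtain ⟨δ, hδ, hδ0⟩ := ((ht.eventually (gt_mem_nhds (ENNReal.ofReal_pos.2 hε))).and
    self_mem_nhdsWithin).exists
  refine ⟨δ, hδ0, fun i s hs hμs => ?_⟩
  rw [eLpNorm_indicator_eq_eLpNorm_restrict hs]
  calc eLpNorm (w i) 1 (μ.restrict s)
      ≤ eLpNorm (w i) q (μ.restrict s) * (μ.restrict s univ) ^ r :=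
        eLpNorm_le_eLpNorm_mul_rpow_measure_univ hq.le (hw i).restrict
    _ ≤ K * (ENNReal.ofReal δ) ^ r := by
        rw [Measure.restrict_apply_univ]
        gcongr
        exact (eLpNorm_mono_measure _ Measure.restrict_le_self).trans (h i)
    _ ≤ _ := hδ.le

variable [IsFiniteMeasure μ]

lemma integrable_areaFn {v : α → F} (hv : Integrable v μ) :
    Integrable (fun t => areaFn (v t)) μ := by
  refine Integrable.mono' (g := fun t => 1 + ‖v t‖) ((integrable_const _).add hv.norm)
    (continuous_areaFn.comp_aestronglyMeasurable hv.1) (ae_of_all _ fun t => ?_)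
  rw [Real.norm_of_nonneg (by linarith [one_le_areaFn (v t)])]
  exact areaFn_le _

variable [InnerProductSpace ℝ F]

/-- The defect of midpoint convexity of `areaFn`. -/
noncomputable def areaGap (u v : F) : ℝ :=
  (areaFn u + areaFn v) / 2 - areaFn ((1 / 2 : ℝ) • u + (1 / 2 : ℝ) • v)

/-- Here `x`, `y` are the lengths of two vectors, `s` is their inner product, `m` the length of
their midpoint, and `x² y² - s²` their Gram determinant. -/
lemma sq_le_of_gram {x y m s δ : ℝ} (hx : 1 ≤ x) (hy : 1 ≤ y)
    (hm2 : m ^ 2 = (x ^ 2 + 2 * s + y ^ 2) / 4) (hδ : δ ^ 2 ≤ (x * y) ^ 2 - s ^ 2) :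
    0 ≤ (x + y) / 2 - m ∧ δ ^ 2 ≤ (x + y) ^ 3 * ((x + y) / 2 - m) := by
  have hxy : 1 ≤ x * y := one_le_mul_of_one_le_of_one_le hx hy
  have hle : s ≤ x * y := le_of_sq_le_sq (by linarith [sq_nonneg δ]) (by linarith)
  have hdiff : (x + y) ^ 2 / 4 - m ^ 2 = (x * y - s) / 2 := by rw [hm2]; ring
  have hmA : m ≤ (x + y) / 2 := le_of_sq_le_sq (by linarith) (by linarith)
  have h1 : δ ^ 2 ≤ 2 * (x * y) * (x * y - s) := by
    have := mul_nonneg (sub_nonneg.2 hle) (sub_nonneg.2 hle)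
    nlinarith
  have h2 : x * y - s ≤ 2 * ((x + y) / 2 - m) * (x + y) := by
    have := mul_nonneg (sub_nonneg.2 hmA) (sub_nonneg.2 hmA)
    nlinarith
  have h3 : 4 * (x * y) ≤ (x + y) ^ 2 := by linarith [sq_nonneg (x - y)]
  refine ⟨by linarith, ?_⟩
  calc δ ^ 2 ≤ 2 * (x * y) * (2 * ((x + y) / 2 - m) * (x + y)) := by
        refine h1.trans ?_
        gcongr
    _ = 4 * (x * y) * (((x + y) / 2 - m) * (x + y)) := by ring
    _ ≤ (x + y) ^ 2 * (((x + y) / 2 - m) * (x + y)) := by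
        apply mul_le_mul_of_nonneg_right h3
        exact mul_nonneg (by linarith) (by linarith)
    _ = _ := by ring

/-- Quantitative strict convexity of `areaFn`, from Lagrange's identity for the vectors `(1, u)`
and `(1, v)`. -/
lemma areaGap_bound (u v : F) :
    0 ≤ areaGap u v ∧ ‖u - v‖ ^ 2 ≤ (areaFn u + areaFn v) ^ 3 * areaGap u v := by
  have hu := one_le_areaFn u
  have hv := one_le_areaFn v
  have hu2 := areaFn_sq u
  have hv2 := areaFn_sq v
  have hm2 := areaFn_sq ((1 / 2 : ℝ) • u + (1 / 2 : ℝ) • v)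
  have hmid : ‖(1 / 2 : ℝ) • u + (1 / 2 : ℝ) • v‖ ^ 2
      = (‖u‖ ^ 2 + 2 * inner ℝ u v + ‖v‖ ^ 2) / 4 := by
    rw [← smul_add, norm_smul, mul_pow, norm_add_sq_real]
    norm_num
    ring
  have hsub := norm_sub_sq_real u v
  have hcs : inner ℝ u v ^ 2 ≤ ‖u‖ ^ 2 * ‖v‖ ^ 2 := by
    rw [← mul_pow]
    exact sq_le_sq' (by linarith [neg_le_of_abs_le (abs_real_inner_le_norm u v)])
      (real_inner_le_norm u v)
  refine sq_le_of_gram (s := 1 + inner ℝ u v) hu hv ?_ ?_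
  · rw [hm2, hmid, hu2, hv2]
    ring
  · rw [mul_pow, hu2, hv2, hsub]
    linarith

/-- If the integrals of `areaFn (w j)` are bounded and the convexity gaps of consecutive terms are
small enough, then `w` converges almost everywhere. -/
lemma ae_exists_tendsto_of_areaGap [CompleteSpace F] {w : ℕ → α → F}
    (hw : ∀ j, Integrable (w j) μ) {K : ℝ} (hK : ∀ j, ∫ t, areaFn (w j t) ∂μ ≤ K)
    (hgap : ∀ j, ∫ t, areaGap (w j t) (w (j + 1) t) ∂μ ≤ 2 * (1 / 64) ^ j) :
    ∀ᵐ t ∂μ, ∃ l, Tendsto (fun j => w j t) atTop (𝓝 l) := by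
  set G : ℕ → α → ℝ := fun j t => areaGap (w j t) (w (j + 1) t) with hG
  set W : ℕ → α → ℝ := fun j t => areaFn (w j t) + areaFn (w (j + 1) t) with hW
  have hφ := fun j => integrable_areaFn (hw j)
  have hWi : ∀ j, Integrable (W j) μ := fun j => (hφ j).add (hφ (j + 1))
  have hGi : ∀ j, Integrable (G j) μ := fun j => by
    refine Integrable.sub ((hWi j).div_const 2) (integrable_areaFn ?_)
    exact ((hw j).smul _).add ((hw (j + 1)).smul _)
  -- The weights `32 ^ j` and `2 ^ (-j)` keep `∑ j, h j` integrable. Where the sum is at most `H`,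
  -- `areaGap_bound` gives `‖w j - w (j + 1)‖ ^ 2 ≤ (2 ^ j * H) ^ 3 * (32 ^ (-j) * H)`, which is
  -- `(H ^ 2 * 2 ^ (-j)) ^ 2`, so the sequence is Cauchy there.
  set h : ℕ → α → ℝ := fun j t => 32 ^ j * G j t + (1 / 2) ^ j * W j t with hh
  have hhi : ∀ j, Integrable (h j) μ := fun j =>
    ((hGi j).const_mul _).add ((hWi j).const_mul _)
  have hG0 : ∀ j t, 0 ≤ G j t := fun j t => (areaGap_bound _ _).1
  have hW0 : ∀ j t, 0 ≤ W j t := fun j t =>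
    add_nonneg (zero_le_one.trans (one_le_areaFn _)) (zero_le_one.trans (one_le_areaFn _))
  have hh0 : ∀ j t, 0 ≤ h j t := fun j t => by
    have := hG0 j t
    have := hW0 j t
    positivity
  have hint : ∀ j, ∫ t, h j t ∂μ ≤ (2 + 2 * K) * (1 / 2) ^ j := fun j => by
    have h1 : ∫ t, h j t ∂μ = 32 ^ j * ∫ t, G j t ∂μ + (1 / 2) ^ j * ∫ t, W j t ∂μ := by
      rw [← integral_const_mul, ← integral_const_mul]
      exact integral_add ((hGi j).const_mul _) ((hWi j).const_mul _)
    have h2 : ∫ t, W j t ∂μ ≤ 2 * K := by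
      have : ∫ t, W j t ∂μ = _ := integral_add (hφ j) (hφ (j + 1))
      linarith [hK j, hK (j + 1)]
    have h3 : (32 : ℝ) ^ j * (1 / 64) ^ j = (1 / 2) ^ j := by rw [← mul_pow]; norm_num
    rw [h1]
    calc (32 : ℝ) ^ j * ∫ t, G j t ∂μ + (1 / 2) ^ j * ∫ t, W j t ∂μ
        ≤ 32 ^ j * (2 * (1 / 64) ^ j) + (1 / 2) ^ j * (2 * K) := by
          gcongr
          exact hgap j
      _ = (2 + 2 * K) * (1 / 2) ^ j := by linear_combination 2 * h3
  have hK0 : 0 ≤ K := (integral_nonneg fun t => zero_le_one.trans (one_le_areaFn _)).trans (hK 0)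
  have hsum : ∫⁻ t, ∑' j, ENNReal.ofReal (h j t) ∂μ < ⊤ := by
    rw [lintegral_tsum fun j => (hhi j).1.aemeasurable.ennreal_ofReal]
    have : Summable fun j : ℕ => (2 + 2 * K) * (1 / 2 : ℝ) ^ j :=
      (summable_geometric_of_lt_one (by norm_num) (by norm_num)).mul_left _
    refine lt_of_le_of_lt (ENNReal.tsum_le_tsum fun j => ?_) this.tsum_ofReal_lt_top
    rw [← ofReal_integral_eq_lintegral_ofReal (hhi j) (ae_of_all _ (hh0 j))]
    exact ENNReal.ofReal_le_ofReal (hint j)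
  have hmeas : AEMeasurable (fun t => ∑' j, ENNReal.ofReal (h j t)) μ :=
    AEMeasurable.tsum fun j => (hhi j).1.aemeasurable.ennreal_ofReal
  filter_upwards [ae_lt_top' hmeas hsum.ne] with t ht
  set H := (∑' j, ENNReal.ofReal (h j t)).toReal
  have hHb : ∀ j, h j t ≤ H := fun j => by
    rw [← ENNReal.toReal_ofReal (hh0 j t)]
    exact ENNReal.toReal_mono ht.ne (ENNReal.le_tsum j)
  have hH0 : 0 ≤ H := ENNReal.toReal_nonneg
  refine cauchySeq_tendsto_of_complete (cauchySeq_of_le_geometric (1 / 2) (H ^ 2) (by norm_num) ?_)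
  intro j
  have h1 : 32 ^ j * G j t ≤ H := by
    have : 0 ≤ (1 / 2) ^ j * W j t := mul_nonneg (by positivity) (hW0 j t)
    have : _ + _ ≤ _ := hHb j
    linarith
  have h2 : (1 / 2) ^ j * W j t ≤ H := by
    have : 0 ≤ 32 ^ j * G j t := mul_nonneg (by positivity) (hG0 j t)
    have : _ + _ ≤ _ := hHb j
    linarith
  have hb : ‖w j t - w (j + 1) t‖ ^ 2 ≤ W j t ^ 3 * G j t := (areaGap_bound _ _).2
  rw [dist_eq_norm]
  refine le_of_sq_le_sq ?_ (by positivity)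
  refine hb.trans ?_
  have h3 : (8 : ℝ) ^ j * (1 / 32) ^ j = ((1 / 2) ^ j) ^ 2 := by
    rw [← mul_pow, ← pow_mul, mul_comm j 2, pow_mul]; norm_num
  have h4 : (2 : ℝ) ^ j * (1 / 2) ^ j = 1 := by rw [← mul_pow]; norm_num
  have h5 : (32 : ℝ) ^ j * (1 / 32) ^ j = 1 := by rw [← mul_pow]; norm_num
  have h6 : ((2 : ℝ) ^ j) ^ 3 = 8 ^ j := by rw [← pow_mul, mul_comm j 3, pow_mul]; norm_num
  have hW2 : W j t ≤ 2 ^ j * H := by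
    calc W j t = 2 ^ j * ((1 / 2) ^ j * W j t) := by rw [← mul_assoc, h4, one_mul]
      _ ≤ _ := by gcongr
  have hG2 : G j t ≤ (1 / 32) ^ j * H := by
    calc G j t = (1 / 32) ^ j * (32 ^ j * G j t) := by
          rw [← mul_assoc, mul_comm ((1 / 32 : ℝ) ^ j), h5, one_mul]
      _ ≤ _ := by gcongr
  calc W j t ^ 3 * G j t ≤ (2 ^ j * H) ^ 3 * ((1 / 32) ^ j * H) := by
        have := hG0 j t
        have := hW0 j t
        gcongr
    _ = 8 ^ j * (1 / 32) ^ j * H ^ 4 := by rw [mul_pow, h6]; ring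
    _ = (H ^ 2 * (1 / 2) ^ j) ^ 2 := by rw [h3]; ring

end Selection
/-! ### Convergent selections from nested convex sets -/

section LimitSelection

variable {F : Type*} [NormedAddCommGroup F] [InnerProductSpace ℝ F]
variable {α : Type*} [MeasurableSpace α] {μ : Measure α} [IsFiniteMeasure μ]

/-- A substitute for weak compactness: a decreasing sequence of nonempty convex sets that is bounded
in `L^q`, `q > 1`, has members `w j ∈ S j` that converge almost everywhere and in `L¹`. They are
chosen to nearly minimise the strictly convex functional `∫ areaFn (w t)` over `S j`. -/
lemma exists_seq_tendsto_of_convex [CompleteSpace F] {q : ℝ≥0∞} (hq : 1 < q)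
    {S : ℕ → Set (α → F)} (hanti : Antitone S) (hne : ∀ k, (S k).Nonempty)
    (hconv : ∀ k, Convex ℝ (S k)) {K : ℝ≥0∞} (hK : K ≠ ⊤)
    (hmeas : ∀ v ∈ S 0, AEStronglyMeasurable v μ) (hbd : ∀ v ∈ S 0, eLpNorm v q μ ≤ K) :
    ∃ (w : ℕ → α → F) (g : α → F), (∀ j, w j ∈ S j) ∧ MemLp g q μ ∧
      (∀ᵐ t ∂μ, Tendsto (fun j => w j t) atTop (𝓝 (g t))) ∧
      Tendsto (fun j => eLpNorm (w j - g) 1 μ) atTop (𝓝 0) := by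
  set Φ : (α → F) → ℝ := fun v => ∫ t, areaFn (v t) ∂μ with hΦ
  have hmem : ∀ v ∈ S 0, MemLp v q μ := fun v hv =>
    ⟨hmeas v hv, (hbd v hv).trans_lt hK.lt_top⟩
  have hint : ∀ v ∈ S 0, Integrable v μ := fun v hv => (hmem v hv).integrable hq.le
  have h0 : ∀ k, S k ⊆ S 0 := fun k => hanti (Nat.zero_le k)
  obtain ⟨K₁, hK₁⟩ : ∃ K₁ : ℝ, ∀ v ∈ S 0, Φ v ≤ K₁ := by
    set c : ℝ≥0∞ := K * μ univ ^ (1 / (1 : ℝ≥0∞).toReal - 1 / q.toReal)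
    have hr : 0 ≤ 1 / (1 : ℝ≥0∞).toReal - 1 / q.toReal := by
      by_cases hqt : q = ⊤
      · simp [hqt]
      · have : 1 < q.toReal := by
          rw [← ENNReal.toReal_one]; exact (ENNReal.toReal_lt_toReal (by simp) hqt).2 hq
        simpa using inv_le_one_of_one_le₀ this.le
    have hc : c ≠ ⊤ := ENNReal.mul_ne_top hK (ENNReal.rpow_ne_top_of_nonneg hr (by simp))
    refine ⟨μ.real univ + c.toReal, fun v hv => ?_⟩
    have h1 : Φ v ≤ ∫ t, (1 + ‖v t‖) ∂μ :=
      integral_mono (integrable_areaFn (hint v hv)) ((integrable_const _).add (hint v hv).norm)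
        fun t => areaFn_le _
    rw [integral_add (integrable_const _) (hint v hv).norm] at h1
    have h2 : ∫ t, ‖v t‖ ∂μ ≤ c.toReal := by
      rw [integral_norm_eq_lintegral_enorm (hmeas v hv), ← eLpNorm_one_eq_lintegral_enorm]
      refine ENNReal.toReal_mono hc ?_
      refine (eLpNorm_le_eLpNorm_mul_rpow_measure_univ hq.le (hmeas v hv)).trans ?_
      exact mul_le_mul_left (hbd v hv) _
    simp only [integral_const, smul_eq_mul, mul_one] at h1
    linarith
  set m : ℕ → ℝ := fun k => sInf (Φ '' S k) with hm
  have hbb : ∀ k, BddBelow (Φ '' S k) := fun k => ⟨0, by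
    rintro _ ⟨v, -, rfl⟩
    exact integral_nonneg fun t => zero_le_one.trans (one_le_areaFn _)⟩
  have hmle : ∀ k, ∀ v ∈ S k, m k ≤ Φ v := fun k v hv => csInf_le (hbb k) ⟨v, hv, rfl⟩
  have hmono : Monotone m := fun i j hij =>
    csInf_le_csInf (hbb i) ((hne j).image _) (image_mono (hanti hij))
  have hba : BddAbove (range m) := ⟨K₁, by
    rintro _ ⟨k, rfl⟩
    obtain ⟨v, hv⟩ := hne k
    exact (hmle k v hv).trans (hK₁ v (h0 k hv))⟩
  set M := ⨆ k, m k
  have hlim : Tendsto m atTop (𝓝 M) := tendsto_atTop_ciSup hmono hba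
  have hpos : ∀ j : ℕ, (0 : ℝ) < (1 / 64) ^ j := fun j => by positivity
  -- far enough along, the infimum over `S k` is within `64 ^ (-j)` of its limit `M`
  obtain ⟨N, hN, hNm⟩ := extraction_forall_of_eventually'
    (P := fun j k => M - (1 / 64 : ℝ) ^ j < m k)
    fun j => (eventually_atTop.1 (hlim.eventually (lt_mem_nhds (sub_lt_self M (hpos j)))))
  have hex : ∀ j, ∃ v ∈ S (N j), Φ v < m (N j) + (1 / 64) ^ j := fun j => by
    obtain ⟨_, ⟨v, hv, rfl⟩, hlt⟩ := exists_lt_of_csInf_lt ((hne (N j)).image Φ)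
      (lt_add_of_pos_right (m (N j)) (hpos j))
    exact ⟨v, hv, hlt⟩
  choose w hwS hwΦ using hex
  have hw0 : ∀ j, w j ∈ S 0 := fun j => h0 _ (hwS j)
  have hwi : ∀ j, Integrable (w j) μ := fun j => hint _ (hw0 j)
  have hgap : ∀ j, ∫ t, areaGap (w j t) (w (j + 1) t) ∂μ ≤ 2 * (1 / 64) ^ j := by
    intro j
    -- the midpoint competes in `S (N j)`, so it cannot lie much below `M`
    have hmid : (1 / 2 : ℝ) • w j + (1 / 2 : ℝ) • w (j + 1) ∈ S (N j) :=
      hconv _ (hwS j) (hanti (hN.monotone j.le_succ) (hwS (j + 1))) (by norm_num) (by norm_num)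
        (by norm_num)
    have h1 : ∫ t, areaGap (w j t) (w (j + 1) t) ∂μ = (Φ (w j) + Φ (w (j + 1))) / 2
        - Φ ((1 / 2 : ℝ) • w j + (1 / 2 : ℝ) • w (j + 1)) := by
      have ha := integrable_areaFn (hwi j)
      have hb := integrable_areaFn (hwi (j + 1))
      unfold areaGap
      have hc := integrable_areaFn (hint _ (h0 _ hmid))
      simp only [Pi.add_apply, Pi.smul_apply] at hc
      rw [integral_sub (by exact (ha.add hb).div_const 2) hc, integral_div, integral_add ha hb]
      rfl
    have h2 := hmle _ _ hmid
    have h3 : m (N j) ≤ M := le_ciSup hba _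
    have h4 : m (N (j + 1)) ≤ M := le_ciSup hba _
    have h5 : (1 / 64 : ℝ) ^ (j + 1) ≤ (1 / 64) ^ j :=
      pow_le_pow_of_le_one (by norm_num) (by norm_num) j.le_succ
    linarith [hwΦ j, hwΦ (j + 1), hNm j]
  have hae := ae_exists_tendsto_of_areaGap hwi (fun j => hK₁ _ (hw0 j)) hgap
  obtain ⟨g, hgm, hg⟩ := exists_stronglyMeasurable_limit_of_tendsto_ae
    (fun j => (hwi j).1) hae
  have hgq : MemLp g q μ := by
    refine ⟨hgm.aestronglyMeasurable, lt_of_le_of_lt ?_ hK.lt_top⟩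
    refine (Lp.eLpNorm_lim_le_liminf_eLpNorm (fun j => (hwi j).1) g hg).trans ?_
    exact (liminf_le_liminf (Eventually.of_forall fun j => hbd _ (hw0 j))).trans
      (liminf_const K).le
  exact ⟨w, g, fun j => hanti hN.le_apply (hwS j), hgq, hg,
    tendsto_Lp_finite_of_tendsto_ae le_rfl (by simp) (fun j => (hwi j).1)
      (memLp_one_iff_integrable.2 (hgq.integrable hq.le))
      (unifIntegrable_of_eLpNorm_le hq (fun j => (hwi j).1) hK fun j => hbd _ (hw0 j)) hg⟩

end LimitSelection
/-! ### Weak derivatives on an interval -/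

section Sobolev

variable {n : ℕ} {a b : ℝ}

lemma integrable_smul_of_tsupport_subset {φ : ℝ → ℝ} (hφ : Continuous φ)
    (hc : HasCompactSupport φ) (hs : tsupport φ ⊆ Ioo a b) {v : ℝ → E n}
    (hv : LocallyIntegrableOn v (Ioo a b)) : Integrable fun t => φ t • v t := by
  rw [← integrableOn_iff_integrable_of_support_subset (s := tsupport φ)]
  · exact (hv.integrableOn_compact_subset hs hc).continuousOn_smul hφ.continuousOn hc
  · exact (Function.support_smul_subset_left φ v).trans (subset_tsupport φ)

lemma intervalIntegral_eq_setIntegral_Ioo {F : Type*} [NormedAddCommGroup F] [NormedSpace ℝ F]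
    (hab : a ≤ b) (f : ℝ → F) : ∫ t in a..b, f t = ∫ t in Ioo a b, f t := by
  rw [intervalIntegral.integral_of_le hab, integral_Ioc_eq_integral_Ioo]

lemma setIntegral_Ioo_eq_integral {F : Type*} [NormedAddCommGroup F] [NormedSpace ℝ F]
    {φ : ℝ → ℝ} (h : tsupport φ ⊆ Ioo a b) (f : ℝ → F) :
    ∫ t in Ioo a b, φ t • f t = ∫ t, φ t • f t :=
  setIntegral_eq_integral_of_forall_compl_eq_zero fun t ht => by
    rw [image_eq_zero_of_notMem_tsupport fun h' => ht (h h'), zero_smul]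

lemma integral_deriv_of_tsupport_subset {φ : ℝ → ℝ} (hφ : ContDiff ℝ ∞ φ)
    (hs : tsupport φ ⊆ Ioo a b) {s : ℝ} (hsb : s ≤ b) :
    ∫ t in Ioo s b, deriv φ t = - φ s := by
  rw [← intervalIntegral_eq_setIntegral_Ioo hsb, intervalIntegral.integral_deriv_eq_sub
    (fun x _ => (hφ.differentiable (by simp)).differentiableAt)
    ((hφ.continuous_deriv (by simp)).intervalIntegrable _ _),
    image_eq_zero_of_notMem_tsupport (x := b) fun h => (lt_irrefl b (hs h).2)]
  simp

/-- Integration by parts for the primitive of an integrable function, by Fubini's theorem on the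
triangle `s ≤ t`. -/
lemma hasWeakDeriv_primitive (hab : a < b) (c : E n) {v : ℝ → E n}
    (hv : IntegrableOn v (Ioo a b)) :
    HasWeakDeriv a b (fun t => c + ∫ s in a..t, v s) v := by
  refine ⟨hv.locallyIntegrableOn, fun φ hφ hc hs => ?_⟩
  have hd : Continuous (deriv φ) := hφ.continuous_deriv (by simp)
  set μ : Measure ℝ := volume.restrict (Ioo a b) with hμ
  have hdi : Integrable (deriv φ) μ :=
    (hd.continuousOn.integrableOn_Icc (μ := volume) (a := a) (b := b)).mono_set Ioo_subset_Icc_self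
  have hprod : Integrable (fun z : ℝ × ℝ => deriv φ z.1 • v z.2) (μ.prod μ) :=
    Integrable.smul_prod hdi hv
  have htri : MeasurableSet {z : ℝ × ℝ | z.2 ≤ z.1} :=
    measurableSet_le measurable_snd measurable_fst
  have hF := hprod.indicator htri
  have hY : ∀ t ∈ Ioo a b, deriv φ t • (∫ s in a..t, v s)
      = ∫ s, {z : ℝ × ℝ | z.2 ≤ z.1}.indicator (fun z => deriv φ z.1 • v z.2) (t, s) ∂μ := by
    intro t ht
    have h1 : ∀ s, {z : ℝ × ℝ | z.2 ≤ z.1}.indicator (fun z => deriv φ z.1 • v z.2) (t, s)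
        = (Iic t).indicator (fun s => deriv φ t • v s) s := fun s => by
      simp [indicator]
    simp only [h1]
    rw [integral_indicator measurableSet_Iic, hμ, Measure.restrict_restrict measurableSet_Iic,
      intervalIntegral.integral_of_le ht.1.le, integral_smul]
    congr 3
    ext s
    simp only [mem_Ioc, mem_inter_iff, mem_Iic, mem_Ioo]
    constructor
    · exact fun h => ⟨h.2, h.1, h.2.trans_lt ht.2⟩
    · exact fun h => ⟨h.2.1, h.1⟩
  have hZ : ∀ s ∈ Ioo a b,
      ∫ t, {z : ℝ × ℝ | z.2 ≤ z.1}.indicator (fun z => deriv φ z.1 • v z.2) (t, s) ∂μ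
      = -(φ s • v s) := by
    intro s hsab
    have h1 : ∀ t, {z : ℝ × ℝ | z.2 ≤ z.1}.indicator (fun z => deriv φ z.1 • v z.2) (t, s)
        = (Ici s).indicator (fun t => deriv φ t • v s) t := fun t => by
      simp [indicator]
    simp only [h1]
    rw [integral_indicator measurableSet_Ici, hμ, Measure.restrict_restrict measurableSet_Ici]
    have h2 : Ici s ∩ Ioo a b = Ico s b := by
      ext t
      simp only [mem_inter_iff, mem_Ici, mem_Ioo, mem_Ico]
      exact ⟨fun h => ⟨h.1, h.2.2⟩, fun h => ⟨h.1, hsab.1.trans_le h.1, h.2⟩⟩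
    rw [h2, integral_smul_const, integral_Ico_eq_integral_Ioo,
      integral_deriv_of_tsupport_subset hφ hs hsab.2.le, neg_smul]
  have hYi : IntegrableOn (fun t => deriv φ t • ∫ s in a..t, v s) (Ioo a b) :=
    (hF.integral_prod_left).congr <| by
      filter_upwards [ae_restrict_mem measurableSet_Ioo] with t ht
      exact (hY t ht).symm
  have hci : IntegrableOn (fun t => deriv φ t • c) (Ioo a b) := hdi.smul_const c
  simp only [smul_add]
  rw [integral_add hci hYi, integral_smul_const,
    integral_deriv_of_tsupport_subset hφ hs hab.le,
    image_eq_zero_of_notMem_tsupport (x := a) fun h => (lt_irrefl a (hs h).1),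
    neg_zero, zero_smul, zero_add, setIntegral_congr_fun measurableSet_Ioo hY]
  have hswap := integral_integral_swap (f := fun t s =>
    {z : ℝ × ℝ | z.2 ≤ z.1}.indicator (fun z => deriv φ z.1 • v z.2) (t, s)) hF
  rw [← hμ, hswap, ← integral_neg]
  exact setIntegral_congr_fun measurableSet_Ioo hZ

lemma HasWeakDeriv.linearComb {y z v w : ℝ → E n} (hy : HasWeakDeriv a b y v)
    (hz : HasWeakDeriv a b z w) (hyc : ContinuousOn y (Icc a b)) (hzc : ContinuousOn z (Icc a b))
    (r s : ℝ) : HasWeakDeriv a b (r • y + s • z) (r • v + s • w) := by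
  refine ⟨LocallyIntegrableOn.add (hy.1.smul r) (hz.1.smul s), fun φ hφ hc hs => ?_⟩
  have hcomb : ∀ (ψ : ℝ → ℝ) (f g : ℝ → E n), Continuous ψ → HasCompactSupport ψ →
      tsupport ψ ⊆ Ioo a b → LocallyIntegrableOn f (Ioo a b) →
      LocallyIntegrableOn g (Ioo a b) → ∫ t in Ioo a b, ψ t • (r • f + s • g) t
        = r • (∫ t in Ioo a b, ψ t • f t) + s • ∫ t in Ioo a b, ψ t • g t := by
    intro ψ f g hψ hψc hψs hf hg
    rw [← integral_smul, ← integral_smul, ← integral_add (by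
      exact ((integrable_smul_of_tsupport_subset hψ hψc hψs hf).smul r).integrableOn) (by
      exact ((integrable_smul_of_tsupport_subset hψ hψc hψs hg).smul s).integrableOn)]
    simp only [Pi.add_apply, Pi.smul_apply, smul_add, smul_comm (ψ _)]
  rw [hcomb _ _ _ (hφ.continuous_deriv (by simp)) hc.deriv
    ((tsupport_deriv_subset).trans hs)
    (hyc.integrableOn_Icc.mono_set Ioo_subset_Icc_self).locallyIntegrableOn
    (hzc.integrableOn_Icc.mono_set Ioo_subset_Icc_self).locallyIntegrableOn,
    hcomb _ _ _ hφ.continuous hc hs hy.1 hz.1, hy.2 φ hφ hc hs, hz.2 φ hφ hc hs]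
  simp only [smul_neg, neg_add]

lemma HasWeakDeriv.ae_unique {y v w : ℝ → E n} (hv : HasWeakDeriv a b y v)
    (hw : HasWeakDeriv a b y w) : v =ᵐ[volume.restrict (Ioo a b)] w := by
  have h := isOpen_Ioo.ae_eq_zero_of_integral_contDiff_smul_eq_zero
    (f := v - w) (U := Ioo a b) (μ := volume) (hv.1.sub hw.1) ?_
  · rw [EventuallyEq, ae_restrict_iff' measurableSet_Ioo]
    filter_upwards [h] with t ht htm
    exact sub_eq_zero.1 (ht htm)
  intro φ hφ hc hs
  simp only [Pi.sub_apply, smul_sub]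
  rw [integral_sub (integrable_smul_of_tsupport_subset hφ.continuous hc hs hv.1)
    (integrable_smul_of_tsupport_subset hφ.continuous hc hs hw.1),
    ← setIntegral_Ioo_eq_integral hs, ← setIntegral_Ioo_eq_integral hs, sub_eq_zero, ← neg_inj,
    ← hv.2 φ hφ hc hs, ← hw.2 φ hφ hc hs]

lemma HasWeakDeriv.weakDeriv_ae_eq {y v : ℝ → E n} (hv : HasWeakDeriv a b y v) :
    weakDeriv a b y =ᵐ[volume.restrict (Ioo a b)] v := by
  have h : ∃ v, HasWeakDeriv a b y v := ⟨v, hv⟩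
  rw [weakDeriv, dif_pos h]
  exact h.choose_spec.ae_unique hv

/-- A test function with integral zero is the derivative of a test function. -/
lemma exists_primitive_of_integral_eq_zero (hab : a < b) {θ : ℝ → ℝ} (hθ : ContDiff ℝ ∞ θ)
    (hc : HasCompactSupport θ) (hs : tsupport θ ⊆ Ioo a b) (h0 : ∫ t in Ioo a b, θ t = 0) :
    ∃ ψ : ℝ → ℝ, ContDiff ℝ ∞ ψ ∧ HasCompactSupport ψ ∧ tsupport ψ ⊆ Ioo a b ∧ deriv ψ = θ := by
  have hθi : ∀ x y, IntervalIntegrable θ volume x y :=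
    fun x y => hθ.continuous.intervalIntegrable _ _
  have hderiv : ∀ t, HasDerivAt (fun t => ∫ s in a..t, θ s) (θ t) t := fun t =>
    hθ.continuous.integral_hasStrictDerivAt a t |>.hasDerivAt
  have hd : deriv (fun t => ∫ s in a..t, θ s) = θ := funext fun t => (hderiv t).deriv
  -- the midpoint is added to have a nonempty set also for `θ = 0`
  set K : Set ℝ := insert ((a + b) / 2) (tsupport θ) with hK
  have hKc : IsCompact K := hc.isCompact.insert _
  have hKne : K.Nonempty := ⟨_, mem_insert _ _⟩
  have hKs : K ⊆ Ioo a b :=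
    insert_subset ⟨by linarith, by linarith⟩ hs
  obtain ⟨hc1, hc2⟩ := hKs (hKc.sInf_mem hKne)
  obtain ⟨hd1, hd2⟩ := hKs (hKc.sSup_mem hKne)
  have hθ0 : ∀ t, t < sInf K ∨ sSup K < t → θ t = 0 := by
    intro t ht
    refine image_eq_zero_of_notMem_tsupport fun hmem => ?_
    have hm : t ∈ K := mem_insert_of_mem _ hmem
    rcases ht with ht | ht
    · exact absurd (csInf_le hKc.bddBelow hm) (not_le.2 ht)
    · exact absurd (le_csSup hKc.bddAbove hm) (not_le.2 ht)
  have hψ0 : ∀ t, t ∉ Icc (sInf K) (sSup K) → ∫ s in a..t, θ s = 0 := by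
    intro t ht
    rw [mem_Icc, not_and_or, not_le, not_le] at ht
    rcases ht with ht | ht
    · refine intervalIntegral.integral_zero_ae (ae_of_all _ fun s hs => hθ0 s (Or.inl ?_))
      exact (uIoc_subset_uIcc hs).2.trans_lt (max_lt hc1 ht)
    · rw [← intervalIntegral.integral_add_adjacent_intervals (hθi a b) (hθi b t),
        intervalIntegral_eq_setIntegral_Ioo hab.le, h0, zero_add]
      refine intervalIntegral.integral_zero_ae (ae_of_all _ fun s hs => hθ0 s (Or.inr ?_))
      exact (lt_min hd2 ht).trans_le (uIoc_subset_uIcc hs).1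
  have hsub : tsupport (fun t => ∫ s in a..t, θ s) ⊆ Icc (sInf K) (sSup K) :=
    closure_minimal (fun t ht => by_contra fun h => ht (hψ0 t h)) isClosed_Icc
  refine ⟨fun t => ∫ s in a..t, θ s, ?_, ?_, ?_, hd⟩
  · rw [contDiff_infty_iff_deriv, hd]
    exact ⟨fun t => (hderiv t).differentiableAt, hθ⟩
  · exact HasCompactSupport.intro isCompact_Icc hψ0
  · exact hsub.trans (Icc_subset_Ioo hc1 hd2)

/-- The du Bois-Reymond lemma. The constant is the mean of `z` against a bump function `ρ` of
integral one. -/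
lemma eqOn_const_of_hasWeakDeriv_zero (hab : a < b) {z : ℝ → E n} (hz : ContinuousOn z (Icc a b))
    (h : HasWeakDeriv a b z 0) : ∃ c, ∀ t ∈ Icc a b, z t = c := by
  have hzl : LocallyIntegrableOn z (Ioo a b) :=
    (hz.integrableOn_Icc.mono_set Ioo_subset_Icc_self).locallyIntegrableOn
  let f : ContDiffBump ((a + b) / 2) :=
    ⟨(b - a) / 8, (b - a) / 4, by linarith, by linarith⟩
  set ρ : ℝ → ℝ := f.normed volume with hρ
  have hρd : ContDiff ℝ ∞ ρ := f.contDiff_normed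
  have hρc : HasCompactSupport ρ := f.hasCompactSupport_normed
  have hρs : tsupport ρ ⊆ Ioo a b := by
    rw [hρ, f.tsupport_normed_eq, Real.closedBall_eq_Icc]
    exact Icc_subset_Ioo (by change a < _ - (b - a) / 4; linarith)
      (by change _ + (b - a) / 4 < b; linarith)
  have hρ1 : ∫ t in Ioo a b, ρ t = 1 := by
    have := setIntegral_Ioo_eq_integral hρs (fun _ => (1 : ℝ))
    simp only [smul_eq_mul, mul_one] at this
    rw [this, hρ, f.integral_normed]
  set c := ∫ t in Ioo a b, ρ t • z t with hc
  refine ⟨c, ?_⟩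
  have hae := isOpen_Ioo.ae_eq_zero_of_integral_contDiff_smul_eq_zero
    (f := fun t => z t - c) (U := Ioo a b) (μ := volume)
    (hzl.sub (locallyIntegrableOn_const c)) ?_
  · refine Measure.eqOn_Icc_of_ae_eq volume hab.ne ?_ hz continuousOn_const
    rw [← restrict_Ioo_eq_restrict_Icc, EventuallyEq, ae_restrict_iff' measurableSet_Ioo]
    filter_upwards [hae] with t ht htm
    exact sub_eq_zero.1 (ht htm)
  intro φ hφ hφc hφs
  have hφi : IntegrableOn φ (Ioo a b) :=
    (hφ.continuous.integrable_of_hasCompactSupport hφc).integrableOn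
  have hρi : IntegrableOn ρ (Ioo a b) :=
    (hρd.continuous.integrable_of_hasCompactSupport hρc).integrableOn
  have hφz : IntegrableOn (fun t => φ t • z t) (Ioo a b) :=
    (integrable_smul_of_tsupport_subset hφ.continuous hφc hφs hzl).integrableOn
  have hρz : IntegrableOn (fun t => ρ t • z t) (Ioo a b) :=
    (integrable_smul_of_tsupport_subset hρd.continuous hρc hρs hzl).integrableOn
  set I := ∫ t in Ioo a b, φ t with hI
  -- subtracting `I • ρ` gives a test function of integral zero, that is, a derivative
  obtain ⟨ψ, hψ, hψc, hψs, hψd⟩ := exists_primitive_of_integral_eq_zero hab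
    (θ := fun t => φ t - I * ρ t) (hφ.sub (contDiff_const.mul hρd))
    (hφc.sub (hρc.mul_left (f := fun _ => I)))
    ((tsupport_sub φ (fun t => I * ρ t)).trans
      (union_subset hφs ((tsupport_mul_subset_right (f := fun _ => I)).trans hρs)))
    (by rw [integral_sub hφi (hρi.const_mul I), integral_const_mul, hρ1, mul_one, sub_self])
  have hkey := h.2 ψ hψ hψc hψs
  rw [hψd] at hkey
  simp only [Pi.zero_apply, smul_zero, integral_zero, neg_zero, sub_smul, mul_smul] at hkey
  rw [integral_sub hφz (by exact hρz.smul I), integral_smul, ← hc] at hkey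
  rw [← setIntegral_Ioo_eq_integral hφs]
  simp only [smul_sub]
  rw [integral_sub hφz (hφi.smul_const c), integral_smul_const, ← hI, hkey]

/-- A continuous function with integrable weak derivative is the primitive of the latter. -/
lemma HasWeakDeriv.eq_primitive (hab : a < b) {y v : ℝ → E n} (hy : ContinuousOn y (Icc a b))
    (h : HasWeakDeriv a b y v) (hv : IntegrableOn v (Ioo a b)) :
    ∀ t ∈ Icc a b, y t = y a + ∫ s in a..t, v s := by
  have hvI : IntegrableOn v (Icc a b) := by rwa [integrableOn_Icc_iff_integrableOn_Ioo]
  have hpc : ContinuousOn (fun t => (0 : E n) + ∫ s in a..t, v s) (Icc a b) :=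
    continuousOn_const.add (intervalIntegral.continuousOn_primitive_interval
      (by rwa [uIcc_of_le hab.le]) |>.mono (by rw [uIcc_of_le hab.le]))
  have hz := h.linearComb (hasWeakDeriv_primitive hab 0 hv) hy hpc 1 (-1)
  have h0 : (1 : ℝ) • v + (-1 : ℝ) • v = 0 := by simp
  rw [h0] at hz
  obtain ⟨c, hc⟩ := eqOn_const_of_hasWeakDeriv_zero hab
    ((hy.const_smul (1 : ℝ)).add (hpc.const_smul (-1 : ℝ))) hz
  intro t ht
  have h1 := hc t ht
  have h2 := hc a (left_mem_Icc.2 hab.le)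
  simp only [Pi.add_apply, Pi.neg_apply, one_smul, neg_smul, zero_add,
    intervalIntegral.integral_same, neg_zero, add_zero] at h1 h2
  rw [h2, ← h1]
  abel

end Sobolev
/-! ### Existence of minimizers for scalarized functionals -/

section Functional

variable {n d : ℕ} {a b q : ℝ} {yA yB : E n} {L : ℝ → E n → E n → E d}

lemma one_lt_ofReal (hq : 1 < q) : 1 < ENNReal.ofReal q := by
  rw [← ENNReal.ofReal_one]
  exact (ENNReal.ofReal_lt_ofReal_iff (by linarith)).2 hq

lemma MemSobolev.hasWeakDeriv {y : ℝ → E n} (hy : MemSobolev a b q y) :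
    HasWeakDeriv a b y (weakDeriv a b y) := by
  obtain ⟨-, v, hv, -⟩ := hy
  have h : ∃ v, HasWeakDeriv a b y v := ⟨v, hv⟩
  rw [weakDeriv, dif_pos h]
  exact h.choose_spec

lemma MemSobolev.memLp_of_hasWeakDeriv {y v : ℝ → E n} (hy : MemSobolev a b q y)
    (hv : HasWeakDeriv a b y v) : MemLp v (ENNReal.ofReal q) (volume.restrict (Ioo a b)) := by
  obtain ⟨-, w, hw, hwq⟩ := hy
  exact hwq.ae_eq (hw.ae_unique hv)

lemma MemSobolev.integrableOn_of_hasWeakDeriv (hq : 1 < q) {y v : ℝ → E n}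
    (hy : MemSobolev a b q y) (hv : HasWeakDeriv a b y v) : IntegrableOn v (Ioo a b) :=
  (hy.memLp_of_hasWeakDeriv hv).integrable (one_lt_ofReal hq).le

/-- The arc with initial value `c` and weak derivative `v`. -/
lemma memSobolev_primitive (hab : a < b) (hq : 1 < q) (c : E n) {v : ℝ → E n}
    (hv : MemLp v (ENNReal.ofReal q) (volume.restrict (Ioo a b))) :
    MemSobolev a b q fun t => c + ∫ s in a..t, v s := by
  have hvi : IntegrableOn v (Ioo a b) := hv.integrable (one_lt_ofReal hq).le
  refine ⟨continuousOn_const.add ?_, v, hasWeakDeriv_primitive hab c hvi, hv⟩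
  rw [← uIcc_of_le hab.le]
  refine intervalIntegral.continuousOn_primitive_interval ?_
  rwa [uIcc_of_le hab.le, integrableOn_Icc_iff_integrableOn_Ioo]

lemma admissible_nonempty (hab : a < b) (hq : 1 < q) : (admissible a b q yA yB).Nonempty := by
  refine ⟨fun t => yA + ∫ _ in a..t, (b - a)⁻¹ • (yB - yA),
    memSobolev_primitive hab hq yA (memLp_const _), by simp, ?_⟩
  have : b - a ≠ 0 := (sub_pos.2 hab).ne'
  simp only [intervalIntegral.integral_const, smul_smul, mul_inv_cancel₀ this, one_smul,
    add_sub_cancel]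

lemma admissible_linearComb {y z : ℝ → E n} (hy : y ∈ admissible a b q yA yB)
    (hz : z ∈ admissible a b q yA yB) {r s : ℝ} (hrs : r + s = 1) :
    r • y + s • z ∈ admissible a b q yA yB := by
  refine ⟨⟨(hy.1.1.const_smul r).add (hz.1.1.const_smul s), _,
    hy.1.hasWeakDeriv.linearComb hz.1.hasWeakDeriv hy.1.1 hz.1.1 r s,
    ((hy.1.memLp_of_hasWeakDeriv hy.1.hasWeakDeriv).const_smul r).add
      ((hz.1.memLp_of_hasWeakDeriv hz.1.hasWeakDeriv).const_smul s)⟩, ?_, ?_⟩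
  · simp only [Pi.add_apply, Pi.smul_apply, hy.2.1, hz.2.1, ← add_smul, hrs, one_smul]
  · simp only [Pi.add_apply, Pi.smul_apply, hy.2.2, hz.2.2, ← add_smul, hrs, one_smul]

lemma J_eq_of_hasWeakDeriv (hab : a < b) {y v : ℝ → E n} (hv : HasWeakDeriv a b y v) :
    J a b L y = ∫ t in Ioo a b, L t (y t) (v t) := by
  rw [J, intervalIntegral_eq_setIntegral_Ioo hab.le]
  refine integral_congr_ae ?_
  filter_upwards [hv.weakDeriv_ae_eq] with t ht
  rw [ht]

/-- The growth condition makes the Lagrangian integrable along every arc. -/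
lemma integrableOn_lagrangian (hab : a < b) (hq : 1 < q)
    (hL : ContinuousOn (fun x : ℝ × E n × E n => L x.1 x.2.1 x.2.2) (Icc a b ×ˢ univ))
    {K₁ : ℝ} (hgrowth : ∀ t ∈ Icc a b, ∀ (y p : E n) (i : Fin d),
      |L t y p i| ≤ K₁ * (‖y‖ ^ q + ‖p‖ ^ q + 1))
    {y v : ℝ → E n} (hy : MemSobolev a b q y) (hv : HasWeakDeriv a b y v) :
    IntegrableOn (fun t => L t (y t) (v t)) (Ioo a b) := by
  have hvq := hy.memLp_of_hasWeakDeriv hv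
  have hmem : ∀ᵐ t ∂(volume.restrict (Ioo a b)), t ∈ Icc a b := by
    filter_upwards [ae_restrict_mem measurableSet_Ioo] with t ht using Ioo_subset_Icc_self ht
  have hmeas : AEStronglyMeasurable (fun t => L t (y t) (v t)) (volume.restrict (Ioo a b)) := by
    -- the Lagrangian is made continuous everywhere by projecting `t` to `[a,b]`
    have hcont : Continuous fun x : ℝ × E n × E n => L (projIcc a b hab.le x.1) x.2.1 x.2.2 := by
      refine hL.comp_continuous (f := fun x : ℝ × E n × E n =>
        ((projIcc a b hab.le x.1 : ℝ), x.2)) ?_ fun x => ⟨(projIcc a b hab.le x.1).2, mem_univ _⟩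
      exact (continuous_subtype_val.comp (continuous_projIcc.comp continuous_fst)).prodMk
        continuous_snd
    have hym : AEStronglyMeasurable y (volume.restrict (Ioo a b)) :=
      (hy.1.integrableOn_Icc.mono_set Ioo_subset_Icc_self).1
    refine (hcont.comp_aestronglyMeasurable
      (aestronglyMeasurable_id.prodMk (hym.prodMk hvq.1))).congr ?_
    filter_upwards [hmem] with t ht
    simp [projIcc_of_mem hab.le ht]
  refine Integrable.of_eval_piLp fun i => ?_
  have h1 : IntegrableOn (fun t => ‖y t‖ ^ q) (Ioo a b) :=
    ((hy.1.norm.rpow_const fun _ _ => Or.inr (by linarith)).integrableOn_Icc).mono_set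
      Ioo_subset_Icc_self
  have h2 : IntegrableOn (fun t => ‖v t‖ ^ q) (Ioo a b) := by
    have := hvq.integrable_norm_rpow (by simp; linarith) (by simp)
    rwa [ENNReal.toReal_ofReal (by linarith)] at this
  refine Integrable.mono' (((h1.add h2).add (integrable_const 1)).const_mul K₁) ?_ ?_
  · exact (EuclideanSpace.proj (𝕜 := ℝ) i).continuous.comp_aestronglyMeasurable hmeas
  · filter_upwards [hmem] with t ht using hgrowth t ht _ _ i

/-- Fatou's lemma for Bochner integrals of functions with a common lower bound. -/
lemma integral_le_of_tendsto_of_le {α : Type*} [MeasurableSpace α] {μ : Measure α}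
    [IsFiniteMeasure μ] {f : ℕ → α → ℝ} {g : α → ℝ} {β c : ℝ} {u : ℕ → ℝ}
    (hf : ∀ j, Integrable (f j) μ) (hg : Integrable g μ)
    (hlim : ∀ᵐ t ∂μ, Tendsto (fun j => f j t) atTop (𝓝 (g t)))
    (hβ : ∀ j, ∀ᵐ t ∂μ, -β ≤ f j t) (hu : ∀ j, ∫ t, f j t ∂μ ≤ u j)
    (huc : Tendsto u atTop (𝓝 c)) : ∫ t, g t ∂μ ≤ c := by
  have hgβ : ∀ᵐ t ∂μ, 0 ≤ g t + β := by
    filter_upwards [hlim, ae_all_iff.2 hβ] with t ht hb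
    linarith [ge_of_tendsto' ht hb]
  have hfβ : ∀ j, ∀ᵐ t ∂μ, 0 ≤ f j t + β := fun j => by
    filter_upwards [hβ j] with t ht
    linarith
  have hfi : ∀ j, Integrable (fun t => f j t + β) μ := fun j => (hf j).add (integrable_const β)
  have hgi : Integrable (fun t => g t + β) μ := hg.add (integrable_const β)
  have hc : 0 ≤ c + μ.real univ * β := by
    refine ge_of_tendsto' (huc.add_const _) fun j => ?_
    have h1 := integral_nonneg_of_ae (hfβ j)
    rw [integral_add (hf j) (integrable_const β), integral_const, smul_eq_mul] at h1
    linarith [hu j]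
  have key : ENNReal.ofReal (∫ t, (g t + β) ∂μ) ≤ ENNReal.ofReal (c + μ.real univ * β) := by
    rw [ofReal_integral_eq_lintegral_ofReal hgi hgβ]
    calc ∫⁻ t, ENNReal.ofReal (g t + β) ∂μ
        = ∫⁻ t, liminf (fun j => ENNReal.ofReal (f j t + β)) atTop ∂μ := by
          refine lintegral_congr_ae ?_
          filter_upwards [hlim] with t ht
          exact ((ENNReal.continuous_ofReal.tendsto _).comp (ht.add_const β)).liminf_eq.symm
      _ ≤ liminf (fun j => ∫⁻ t, ENNReal.ofReal (f j t + β) ∂μ) atTop :=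
          lintegral_liminf_le' fun j => (hfi j).1.aemeasurable.ennreal_ofReal
      _ ≤ liminf (fun j => ENNReal.ofReal (u j + μ.real univ * β)) atTop := by
          refine liminf_le_liminf (Eventually.of_forall fun j => ?_)
          rw [← ofReal_integral_eq_lintegral_ofReal (hfi j) (hfβ j),
            integral_add (hf j) (integrable_const β), integral_const, smul_eq_mul]
          exact ENNReal.ofReal_le_ofReal (by linarith [hu j])
      _ = _ := ((ENNReal.continuous_ofReal.tendsto _).comp (huc.add_const _)).liminf_eq
  rw [ENNReal.ofReal_le_ofReal_iff hc, integral_add hg (integrable_const β), integral_const,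
    smul_eq_mul] at key
  linarith

/-- Scalarizing a cone-convex map with an element of the dual cone gives a convex function. -/
lemma convexOn_inner_of_setConvex {X : Type*} [AddCommMonoid X] [Module ℝ X]
    {C : ProperCone ℝ (E d)} {f : X → E d}
    (hf : SetConvex fun x : X => {f x} + (C : Set (E d))) {ζ : E d} (hζ : ζ ∈ dualCone C) :
    ConvexOn ℝ univ fun x => inner ℝ ζ (f x) := by
  refine ⟨convex_univ, fun x _ x' _ r s hr hs hrs => ?_⟩
  have hmem : ∀ x, (x, f x) ∈ {x : X × E d | x.2 ∈ ({f x.1} + (C : Set (E d)) : Set (E d))} :=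
    fun x => ⟨f x, rfl, 0, C.zero_mem, add_zero _⟩
  obtain ⟨_, rfl, c, hc, h⟩ := hf (hmem x) (hmem x') hr hs hrs
  have h0 : 0 ≤ inner ℝ c ζ := hζ hc
  have h1 : f (r • x + s • x') + c = r • f x + s • f x' := h
  have h2 := congrArg (fun z => inner ℝ ζ z) h1
  simp only [inner_add_right, inner_smul_right] at h2
  rw [real_inner_comm] at h0
  simp only [smul_eq_mul]
  linarith

lemma inner_J_eq (hab : a < b) (hq : 1 < q)
    (hL : ContinuousOn (fun x : ℝ × E n × E n => L x.1 x.2.1 x.2.2) (Icc a b ×ˢ univ))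
    {K₁ : ℝ} (hgrowth : ∀ t ∈ Icc a b, ∀ (y p : E n) (i : Fin d),
      |L t y p i| ≤ K₁ * (‖y‖ ^ q + ‖p‖ ^ q + 1)) (ζ : E d)
    {y v : ℝ → E n} (hy : MemSobolev a b q y) (hv : HasWeakDeriv a b y v) :
    inner ℝ ζ (J a b L y) = ∫ t in Ioo a b, inner ℝ ζ (L t (y t) (v t)) := by
  rw [J_eq_of_hasWeakDeriv hab hv,
    integral_inner (integrableOn_lagrangian hab hq hL hgrowth hy hv)]

/-- The scalarized functional is convex on the admissible arcs. -/
lemma inner_J_linearComb_le (hab : a < b) (hq : 1 < q)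
    (hL : ContinuousOn (fun x : ℝ × E n × E n => L x.1 x.2.1 x.2.2) (Icc a b ×ˢ univ))
    {K₁ : ℝ} (hgrowth : ∀ t ∈ Icc a b, ∀ (y p : E n) (i : Fin d),
      |L t y p i| ≤ K₁ * (‖y‖ ^ q + ‖p‖ ^ q + 1)) {ζ : E d}
    (hconv : ∀ t ∈ Icc a b, ConvexOn ℝ univ fun x : E n × E n => inner ℝ ζ (L t x.1 x.2))
    {y z : ℝ → E n} (hy : y ∈ admissible a b q yA yB) (hz : z ∈ admissible a b q yA yB)
    {r s : ℝ} (hr : 0 ≤ r) (hs : 0 ≤ s) (hrs : r + s = 1) :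
    inner ℝ ζ (J a b L (r • y + s • z))
      ≤ r * inner ℝ ζ (J a b L y) + s * inner ℝ ζ (J a b L z) := by
  have hyd := hy.1.hasWeakDeriv
  have hzd := hz.1.hasWeakDeriv
  have hcd := hyd.linearComb hzd hy.1.1 hz.1.1 r s
  have hc := (admissible_linearComb hy hz hrs).1
  have hint := fun {y v : ℝ → E n} (hy : MemSobolev a b q y) (hv : HasWeakDeriv a b y v) =>
    (integrableOn_lagrangian hab hq hL hgrowth hy hv).const_inner (𝕜 := ℝ) ζ
  rw [inner_J_eq hab hq hL hgrowth ζ hc hcd, inner_J_eq hab hq hL hgrowth ζ hy.1 hyd,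
    inner_J_eq hab hq hL hgrowth ζ hz.1 hzd, ← integral_const_mul, ← integral_const_mul,
    ← integral_add ((hint hy.1 hyd).const_mul r) ((hint hz.1 hzd).const_mul s)]
  refine setIntegral_mono_on (hint hc hcd)
    (((hint hy.1 hyd).const_mul r).add ((hint hz.1 hzd).const_mul s)) measurableSet_Ioo
    fun t ht => ?_
  exact (hconv t (Ioo_subset_Icc_self ht)).2 (mem_univ (y t, weakDeriv a b y t))
    (mem_univ (z t, weakDeriv a b z t)) hr hs hrs

/-- The direct method: a coercive, convex scalar functional attains its minimum. -/
theorem exists_isZetaSolution (hab : a < b) (hq : 1 < q)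
    (hL : ContinuousOn (fun x : ℝ × E n × E n => L x.1 x.2.1 x.2.2) (Icc a b ×ˢ univ))
    {K₁ : ℝ} (hgrowth : ∀ t ∈ Icc a b, ∀ (y p : E n) (i : Fin d),
      |L t y p i| ≤ K₁ * (‖y‖ ^ q + ‖p‖ ^ q + 1)) {ζ : E d}
    (hconv : ∀ t ∈ Icc a b, ConvexOn ℝ univ fun x : E n × E n => inner ℝ ζ (L t x.1 x.2))
    {α β : ℝ} (hα : 0 < α)
    (hcoer : ∀ t ∈ Icc a b, ∀ y p : E n, α * ‖p‖ ^ q - β ≤ inner ℝ ζ (L t y p)) :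
    ∃ y, IsZetaSolution a b L (admissible a b q yA yB) ζ y := by
  have hq0 : 0 < q := by linarith
  set 𝒳 := admissible a b q yA yB with h𝒳
  set μ : Measure ℝ := volume.restrict (Ioo a b) with hμ
  have hint := fun {y v : ℝ → E n} (hy : MemSobolev a b q y) (hv : HasWeakDeriv a b y v) =>
    (integrableOn_lagrangian hab hq hL hgrowth hy hv).const_inner (𝕜 := ℝ) ζ
  have hJ := fun {y v : ℝ → E n} (hy : MemSobolev a b q y) (hv : HasWeakDeriv a b y v) =>
    inner_J_eq hab hq hL hgrowth ζ hy hv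
  have hpow : ∀ {y v : ℝ → E n}, MemSobolev a b q y → HasWeakDeriv a b y v →
      Integrable (fun t => ‖v t‖ ^ q) μ := fun hy hv => by
    have := (hy.memLp_of_hasWeakDeriv hv).integrable_norm_rpow (by simpa using hq0) (by simp)
    rwa [ENNReal.toReal_ofReal hq0.le] at this
  have hJge : ∀ {y v : ℝ → E n}, MemSobolev a b q y → HasWeakDeriv a b y v →
      α * (∫ t, ‖v t‖ ^ q ∂μ) - μ.real univ * β ≤ inner ℝ ζ (J a b L y) := by
    intro y v hy hv
    rw [hJ hy hv, ← integral_const_mul, ← smul_eq_mul (μ.real univ), ← integral_const,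
      ← integral_sub ((hpow hy hv).const_mul α) (integrable_const β)]
    exact setIntegral_mono_on (((hpow hy hv).const_mul α).sub (integrable_const β)) (hint hy hv)
      measurableSet_Ioo fun t ht => hcoer t (Ioo_subset_Icc_self ht) _ _
  have hbdd : BddBelow ((fun y => inner ℝ ζ (J a b L y)) '' 𝒳) := by
    refine ⟨-(μ.real univ * β), ?_⟩
    rintro _ ⟨y, hy, rfl⟩
    have h1 := hJge hy.1 hy.1.hasWeakDeriv
    have h2 : 0 ≤ α * ∫ t, ‖weakDeriv a b y t‖ ^ q ∂μ :=
      mul_nonneg hα.le (integral_nonneg fun t => by positivity)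
    dsimp only
    linarith
  set I := sInf ((fun y => inner ℝ ζ (J a b L y)) '' 𝒳) with hI
  have hIle : ∀ y ∈ 𝒳, I ≤ inner ℝ ζ (J a b L y) := fun y hy => csInf_le hbdd ⟨y, hy, rfl⟩
  -- All weak derivatives are admitted, and not only the chosen `weakDeriv a b y`, since the chosen
  -- ones are linear in `y` only up to null sets.
  set S : ℕ → Set (ℝ → E n) := fun k => {v | ∃ y ∈ 𝒳, HasWeakDeriv a b y v ∧
    inner ℝ ζ (J a b L y) ≤ I + 1 / ((k : ℝ) + 1)} with hS
  have hanti : Antitone S := by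
    rintro k l hkl v ⟨y, hy, hv, hle⟩
    exact ⟨y, hy, hv, hle.trans (add_le_add_right (Nat.one_div_le_one_div hkl) _)⟩
  have hne : ∀ k, (S k).Nonempty := fun k => by
    obtain ⟨_, ⟨y, hy, rfl⟩, hlt⟩ := exists_lt_of_csInf_lt
      ((admissible_nonempty (yA := yA) (yB := yB) hab hq).image fun y => inner ℝ ζ (J a b L y))
      (lt_add_of_pos_right I (Nat.one_div_pos_of_nat (α := ℝ) (n := k)))
    exact ⟨_, y, hy, hy.1.hasWeakDeriv, hlt.le⟩
  have hSconv : ∀ k, Convex ℝ (S k) := by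
    rintro k v ⟨y, hy, hv, hyl⟩ w ⟨z, hz, hw, hzl⟩ r s hr hs hrs
    refine ⟨r • y + s • z, admissible_linearComb hy hz hrs,
      hv.linearComb hw hy.1.1 hz.1.1 r s, ?_⟩
    refine (inner_J_linearComb_le hab hq hL hgrowth hconv hy hz hr hs hrs).trans ?_
    have h1 := mul_le_mul_of_nonneg_left hyl hr
    have h2 := mul_le_mul_of_nonneg_left hzl hs
    have h3 : r * (I + 1 / ((k : ℝ) + 1)) + s * (I + 1 / ((k : ℝ) + 1))
        = I + 1 / ((k : ℝ) + 1) := by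
      rw [← add_mul, hrs, one_mul]
    linarith
  obtain ⟨w, g, hwS, hgq, hwg, hwL1⟩ := exists_seq_tendsto_of_convex (μ := μ)
    (K := ENNReal.ofReal (((I + 1 + μ.real univ * β) / α) ^ q⁻¹))
    (one_lt_ofReal hq) hanti hne hSconv ENNReal.ofReal_ne_top
    (by
      rintro v ⟨y, hy, hv, -⟩
      exact (hy.1.memLp_of_hasWeakDeriv hv).1)
    (by
      rintro v ⟨y, hy, hv, hle⟩
      rw [(hy.1.memLp_of_hasWeakDeriv hv).eLpNorm_eq_integral_rpow_norm (by simpa using hq0)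
        (by simp), ENNReal.toReal_ofReal hq0.le]
      refine ENNReal.ofReal_le_ofReal (Real.rpow_le_rpow (integral_nonneg fun t => by positivity)
        ?_ (inv_nonneg.2 hq0.le))
      rw [le_div_iff₀ hα]
      have := hJge hy.1 hv
      simp only [CharP.cast_eq_zero, zero_add, div_one] at hle
      linarith)
  choose y hy𝒳 hyw hyle using hwS
  set Y : ℝ → E n := fun t => yA + ∫ s in a..t, g s with hY
  have hgi : Integrable g μ := hgq.integrable (one_lt_ofReal hq).le
  have hYS : MemSobolev a b q Y := memSobolev_primitive hab hq yA hgq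
  have hYg : HasWeakDeriv a b Y g := hasWeakDeriv_primitive hab yA hgi
  have hwi : ∀ j, IntegrableOn (w j) (Ioo a b) := fun j =>
    (hy𝒳 j).1.integrableOn_of_hasWeakDeriv hq (hyw j)
  have hyY : ∀ t ∈ Icc a b, Tendsto (fun j => y j t) atTop (𝓝 (Y t)) := by
    intro t ht
    have hIoo : ∀ f : ℝ → E n, ∫ s in a..t, f s = ∫ s in Ioo a t, f s ∂μ := fun f => by
      rw [intervalIntegral_eq_setIntegral_Ioo ht.1, hμ, Measure.restrict_restrict measurableSet_Ioo,
        inter_eq_left.2 (Ioo_subset_Ioo_right ht.2)]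
    have h1 : ∀ j, y j t = yA + ∫ s in Ioo a t, w j s ∂μ := fun j => by
      rw [(hyw j).eq_primitive hab (hy𝒳 j).1.1 (hwi j) t ht, (hy𝒳 j).2.1, hIoo]
    simp only [h1, hY, hIoo]
    exact tendsto_const_nhds.add (tendsto_setIntegral_of_L1' g hgi.1
      (Eventually.of_forall hwi) hwL1 _)
  have hY𝒳 : Y ∈ 𝒳 := by
    refine ⟨hYS, by simp [hY], ?_⟩
    refine tendsto_nhds_unique (hyY b (right_mem_Icc.2 hab.le)) ?_
    simp only [(hy𝒳 _).2.2]
    exact tendsto_const_nhds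
  refine ⟨Y, hY𝒳, fun z hz => le_trans ?_ (hIle z hz)⟩
  rw [hJ hYS hYg]
  refine integral_le_of_tendsto_of_le (f := fun j t => inner ℝ ζ (L t (y j t) (w j t))) (β := β)
    (u := fun j => I + 1 / ((j : ℝ) + 1)) (fun j => hint (hy𝒳 j).1 (hyw j)) (hint hYS hYg)
    ?_ ?_ (fun j => ?_) ?_
  · filter_upwards [hwg, ae_restrict_mem measurableSet_Ioo] with t ht htm
    have htI := Ioo_subset_Icc_self htm
    refine Tendsto.inner tendsto_const_nhds ?_
    have hc : Continuous fun x : E n × E n => L t x.1 x.2 :=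
      hL.comp_continuous (f := fun x : E n × E n => (t, x)) (by fun_prop)
        fun x => ⟨htI, mem_univ _⟩
    exact (hc.tendsto (Y t, g t)).comp ((hyY t htI).prodMk_nhds ht)
  · intro j
    filter_upwards [ae_restrict_mem measurableSet_Ioo] with t htm
    have h1 := hcoer t (Ioo_subset_Icc_self htm) (y j t) (w j t)
    have h2 : 0 ≤ α * ‖w j t‖ ^ q := by positivity
    linarith
  · rw [← hJ (hy𝒳 j).1 (hyw j)]
    exact hyle j
  · simpa using (tendsto_one_div_add_atTop_nhds_zero_nat (𝕜 := ℝ)).const_add I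

end Functional
/-! ### Infimizers -/

section Infimizer

variable {n d : ℕ} {a b : ℝ} {L : ℝ → E n → E n → E d} {C : ProperCone ℝ (E d)}

/-- The selections `L + c / (b - a)` with constant `c ∈ C` of the set-valued Lagrangian. -/
lemma J_add_mem_Jbar (hab : a < b) {y : ℝ → E n}
    (hint : IntegrableOn (fun t => L t (y t) (weakDeriv a b y t)) (Ioo a b)) {c : E d}
    (hc : c ∈ C) : J a b L y + c ∈ Jbar a b C L y := by
  have hba : 0 < b - a := sub_pos.2 hab
  rw [← integrableOn_Icc_iff_integrableOn_Ioo] at hint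
  have hci : IntegrableOn (fun _ : ℝ => (b - a)⁻¹ • c) (Icc a b) := integrableOn_const (by simp)
  refine ⟨fun t => L t (y t) (weakDeriv a b y t) + (b - a)⁻¹ • c, hint.add hci,
    ae_of_all _ fun t => ⟨_, rfl, _, C.smul_mem hc (inv_nonneg.2 hba.le), rfl⟩, ?_⟩
  rw [intervalIntegral.integral_add
    ((intervalIntegrable_iff_integrableOn_Icc_of_le hab.le).2 hint)
    ((intervalIntegrable_iff_integrableOn_Icc_of_le hab.le).2 hci),
    intervalIntegral.integral_const, smul_smul, mul_inv_cancel₀ hba.ne', one_smul]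
  rfl

/-- Each direction of the dual cone attains its minimum over `Jbar y` at `J y`. -/
lemma inner_J_le_of_mem_Jbar (hab : a < b) {y : ℝ → E n}
    (hint : IntegrableOn (fun t => L t (y t) (weakDeriv a b y t)) (Ioo a b)) {ζ : E d}
    (hζ : ζ ∈ dualCone C) {z : E d} (hz : z ∈ Jbar a b C L y) :
    inner ℝ ζ (J a b L y) ≤ inner ℝ ζ z := by
  obtain ⟨f, hf, hfs, rfl⟩ := hz
  rw [← integrableOn_Icc_iff_integrableOn_Ioo] at hint
  rw [J, intervalIntegral.integral_of_le hab.le, intervalIntegral.integral_of_le hab.le,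
    ← integral_Icc_eq_integral_Ioc, ← integral_Icc_eq_integral_Ioc, ← integral_inner hint,
    ← integral_inner hf]
  refine integral_mono_ae (hint.const_inner ζ) (hf.const_inner ζ) ?_
  filter_upwards [hfs] with t ht
  obtain ⟨_, rfl, c, hc, h⟩ := ht
  have h0 : 0 ≤ inner ℝ c ζ := hζ hc
  have h1 : L t (y t) (weakDeriv a b y t) + c = f t := h
  rw [real_inner_comm] at h0
  rw [← h1, inner_add_right]
  linarith

/-- A set of arcs that contains a `ζ`-solution for each direction `ζ` of a base of the dual cone is
an infimizer: a point of the larger closed convex set outside the smaller one would be separated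
from it by an element of the dual cone. -/
theorem isInfimizer_of_forall_isZetaSolution (hab : a < b) {𝒳 M : Set (ℝ → E n)} (hM : M ⊆ 𝒳)
    (hint : ∀ y ∈ 𝒳, IntegrableOn (fun t => L t (y t) (weakDeriv a b y t)) (Ioo a b))
    {B : Set (E d)} (hB : IsConeBase (dualCone C) B) (hne : B.Nonempty)
    (hsol : ∀ ζ ∈ B, ∃ y ∈ M, IsZetaSolution a b L 𝒳 ζ y) : IsInfimizer a b C L 𝒳 M := by
  refine ⟨hM, Subset.antisymm
    (closure_mono (convexHull_mono (sUnion_subset_sUnion (image_mono hM)))) ?_⟩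
  set D := infG (Jbar a b C L '' M) with hD
  have hDconv : Convex ℝ D := (convex_convexHull ℝ _).closure
  have hDmem : ∀ y ∈ M, ∀ c ∈ C, J a b L y + c ∈ D := fun y hy c hc =>
    subset_closure (subset_convexHull ℝ _
      ⟨_, mem_image_of_mem _ hy, J_add_mem_Jbar hab (hint y (hM hy)) hc⟩)
  refine closure_minimal (convexHull_min ?_ hDconv) isClosed_closure
  rintro z ⟨_, ⟨x, hx, rfl⟩, hz⟩
  by_contra hzD
  obtain ⟨f, u, hfz, hfD⟩ := geometric_hahn_banach_point_closed hDconv isClosed_closure hzD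
  set ξ : E d := (InnerProductSpace.toDual ℝ (E d)).symm f with hξ
  have hfξ : ∀ v, f v = inner ℝ ξ v := fun v => by
    rw [hξ, InnerProductSpace.toDual_symm_apply]
  obtain ⟨ζ₁, hζ₁⟩ := hne
  obtain ⟨y₁, hy₁, -⟩ := hsol ζ₁ hζ₁
  -- `D` contains the ray `J y₁ + r • c`, so `ξ` cannot be negative at `c`
  have hξC : ξ ∈ dualCone C := by
    intro c hc
    change 0 ≤ inner ℝ c ξ
    rw [real_inner_comm]
    by_contra! hneg
    have h1 : ∀ r : ℝ, 0 ≤ r → u < inner ℝ ξ (J a b L y₁) + r * inner ℝ ξ c := fun r hr => by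
      have := hfD _ (hDmem y₁ hy₁ _ (C.smul_mem hc hr))
      rwa [hfξ, inner_add_right, inner_smul_right] at this
    have h2 := h1 0 le_rfl
    have h3 := h1 ((inner ℝ ξ (J a b L y₁) - u) / -inner ℝ ξ c)
      (div_nonneg (by linarith) (by linarith))
    have h4 : (inner ℝ ξ (J a b L y₁) - u) / -inner ℝ ξ c * inner ℝ ξ c
        = -(inner ℝ ξ (J a b L y₁) - u) := by
      rw [div_neg, neg_mul, div_mul_cancel₀ _ hneg.ne]
    linarith
  have hξ0 : ξ ≠ 0 := by
    intro h0
    have h1 := hfD _ (hDmem y₁ hy₁ 0 C.zero_mem)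
    rw [hfξ, h0, inner_zero_left] at h1 hfz
    linarith
  obtain ⟨⟨ζ, s⟩, ⟨hζB, hs, hξs⟩, -⟩ := hB.2 ξ ⟨hξC, hξ0⟩
  obtain ⟨y, hy, -, hmin⟩ := hsol ζ hζB
  have h1 := inner_J_le_of_mem_Jbar hab (hint x hx) (hB.1 hζB).1 hz
  have h2 := mul_le_mul_of_nonneg_left ((hmin x hx).trans h1) hs.le
  have h3 := hfD _ (hDmem y hy 0 C.zero_mem)
  dsimp only at hξs hs
  rw [hfξ, hξs, real_inner_smul_left] at hfz
  rw [hfξ, hξs, real_inner_smul_left, add_zero] at h3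
  linarith

lemma IsConeBase.nonempty {B : Set (E d)} (hB : IsConeBase (dualCone C) B) (hC : C ≠ ⊤) :
    B.Nonempty := by
  obtain ⟨x, hx⟩ : ∃ x, x ∉ C := by
    by_contra! h
    exact hC (eq_top_iff.2 fun x _ => h x)
  obtain ⟨ζ, hζ, hlt⟩ := C.hyperplane_separation' hx
  obtain ⟨⟨ζ₀, s⟩, ⟨h, -⟩, -⟩ := hB.2 ζ ⟨fun c hc => hζ c hc, fun h0 => by
    have h0' : ζ = 0 := h0
    simp [h0'] at hlt⟩
  exact ⟨ζ₀, h⟩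

lemma IsZetaSolution.smul {𝒳 : Set (ℝ → E n)} {ζ : E d} {y : ℝ → E n}
    (h : IsZetaSolution a b L 𝒳 ζ y) {s : ℝ} (hs : 0 ≤ s) :
    IsZetaSolution a b L 𝒳 (s • ζ) y := by
  refine ⟨h.1, fun w hw => ?_⟩
  simp only [real_inner_smul_left]
  exact mul_le_mul_of_nonneg_left (h.2 w hw) hs

end Infimizer
end SetCalcVar

open SetCalcVar in
theorem mainTheorem1 {n d : ℕ} (hn : 0 < n) (hd : 1 < d)
    (a b : ℝ) (hab : a < b) (q : ℝ) (hq : 1 < q)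
    (yA yB : SetCalcVar.E n)
    (C : ProperCone ℝ (SetCalcVar.E d)) (hC : C ≠ ⊤)
    (L : ℝ → SetCalcVar.E n → SetCalcVar.E n → SetCalcVar.E d)
    (hL : ContDiffOn ℝ 1
      (fun x : ℝ × SetCalcVar.E n × SetCalcVar.E n => L x.1 x.2.1 x.2.2)
      (Set.Icc a b ×ˢ Set.univ))
    (hgrowth : ∃ K₁ : ℝ, ∀ t ∈ Set.Icc a b, ∀ (y p : SetCalcVar.E n) (i : Fin d),
      |L t y p i| ≤ K₁ * (‖y‖ ^ q + ‖p‖ ^ q + 1))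
    (B : Set (SetCalcVar.E d))
    (hB : SetCalcVar.IsConeBase (SetCalcVar.dualCone C) B)
    (hcoercive : ∃ α > 0, ∃ β ≥ 0, ∀ ζ ∈ B, ∀ t ∈ Set.Icc a b, ∀ y p : SetCalcVar.E n,
      α * ‖p‖ ^ q - β ≤ inner ℝ ζ (L t y p))
    (hconvex : ∀ t ∈ Set.Icc a b,
      SetCalcVar.SetConvex fun x : SetCalcVar.E n × SetCalcVar.E n =>
        SetCalcVar.Lbar C L t x.1 x.2) :
    (∀ ζ ∈ (SetCalcVar.dualCone C : Set (SetCalcVar.E d)) \ {0},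
      ∃ y, SetCalcVar.IsZetaSolution a b L (SetCalcVar.admissible a b q yA yB) ζ y) ∧
    (∀ yζ : SetCalcVar.E d → ℝ → SetCalcVar.E n,
      (∀ ζ ∈ B,
        SetCalcVar.IsZetaSolution a b L (SetCalcVar.admissible a b q yA yB) ζ (yζ ζ)) →
      SetCalcVar.IsCPlusSolution a b C L (SetCalcVar.admissible a b q yA yB) (yζ '' B)) ∧
    SetCalcVar.IsCPlusSolution a b C L (SetCalcVar.admissible a b q yA yB)
      {y | ∃ ζ ∈ B,
        SetCalcVar.IsZetaSolution a b L (SetCalcVar.admissible a b q yA yB) ζ y} := by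
  obtain ⟨K₁, hK₁⟩ := hgrowth
  obtain ⟨α, hα, β, -, hcoer⟩ := hcoercive
  have hLc := hL.continuousOn
  have hex : ∀ ζ ∈ B, ∃ y, IsZetaSolution a b L (admissible a b q yA yB) ζ y := fun ζ hζ =>
    exists_isZetaSolution hab hq hLc hK₁
      (fun t ht => convexOn_inner_of_setConvex (f := fun x : E n × E n => L t x.1 x.2)
        (hconvex t ht) (hB.1 hζ).1) hα (hcoer ζ hζ)
  have hint : ∀ y ∈ admissible a b q yA yB,
      MeasureTheory.IntegrableOn (fun t => L t (y t) (weakDeriv a b y t)) (Set.Ioo a b) :=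
    fun y hy => integrableOn_lagrangian hab hq hLc hK₁ hy.1 hy.1.hasWeakDeriv
  have hne := hB.nonempty hC
  refine ⟨fun ζ hζ => ?_, fun yζ hyζ => ⟨?_, ?_⟩, ?_, ?_⟩
  · obtain ⟨⟨ζ₀, s⟩, ⟨hζ₀, hs, rfl⟩, -⟩ := hB.2 ζ hζ
    obtain ⟨y, hy⟩ := hex ζ₀ hζ₀
    exact ⟨y, hy.smul hs.le⟩
  · refine isInfimizer_of_forall_isZetaSolution hab ?_ hint hB hne fun ζ hζ =>
      ⟨yζ ζ, Set.mem_image_of_mem _ hζ, hyζ ζ hζ⟩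
    rintro _ ⟨ζ, hζ, rfl⟩
    exact (hyζ ζ hζ).1
  · rintro _ ⟨ζ, hζ, rfl⟩
    exact ⟨ζ, hB.1 hζ, hyζ ζ hζ⟩
  · refine isInfimizer_of_forall_isZetaSolution hab ?_ hint hB hne fun ζ hζ => ?_
    · rintro y ⟨ζ, -, hy⟩
      exact hy.1
    · obtain ⟨y, hy⟩ := hex ζ hζ
      exact ⟨y, ⟨ζ, hζ, hy⟩, hy⟩
  · rintro y ⟨ζ, hζ, hy⟩
    exact ⟨ζ, hB.1 hζ, hy⟩
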